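/- Let $\mu$ be a probability measure on $[0,1]$ with mean $m=\int_0^1 x\,d\mu(x)$, and let $M^*=\sup\{x\in[0,1]:\mu((x,1])>0\}$ be the maximum of its support. Consider two arms that give rewards in $\{0,1\}$: the left arm $L$ has known success probability $p\in[0,1]$; the success probability $\theta$ of the right arm $R$ is drawn from $\mu$ before the game starts, and given $\theta$ the draws are independent. In the game with horizon $T$, two players, Alice and Bob, each pull one arm in every round $t=0,\dots,T$. A player receives the reward of the arm pulled (when both pull the same arm they may receive either one common draw or two separate draws; the result holds under both conventions), and after each round observes the own reward and the action of the opponent, but not the opponent's reward. A pure strategy chooses the next arm from the past actions of both players and the own past rewards; a mixed strategy is a probability distribution over pure strategies. The game is zero-sum: the utility of a player is the own total reward minus the opponent's total reward. A player explores if he pulls $R$ at least once. 1. If $p>(m+M^*)/2$, then for every horizon $T\ge 0$ and every Nash equilibrium $(\sigma_A,\sigma_B)$ of the zero-sum game, with probability $1$ neither player explores. 2. For every $p<M^*$ there is $T_0$ such that for all $T\ge T_0$, every strategy (pure or mixed) of a single player who faces the same two arms alone in rounds $0,\dots,T$ and that maximizes the player's expected total reward explores with positive probability. -/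

import Mathlib

/-- The predictable arm `left` and the risky arm `right`. -/
inductive Arm
  | left
  | right
  deriving DecidableEq

instance : Fintype Arm := ⟨{.left, .right}, fun a => by cases a <;> decide⟩

/-- The two players. -/
inductive Player
  | alice
  | bob
  deriving DecidableEq

instance : Fintype Player := ⟨{.alice, .bob}, fun i => by cases i <;> decide⟩

/-- The opponent of a player. -/
def Player.other : Player → Player
  | .alice => .bob
  | .bob => .alice

noncomputable section

/-! ### Arms and rewards -/

/-- The mean `m` of the prior `μ`. -/
def priorMean (μ : MeasureTheory.Measure ℝ) : ℝ := ∫ x, x ∂μ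

/-- The maximum `M*` of the support of the prior `μ` on `[0, 1]`. -/
def priorMax (μ : MeasureTheory.Measure ℝ) : ℝ :=
  sSup {x : ℝ | x ∈ Set.Icc (0 : ℝ) 1 ∧ 0 < μ (Set.Ioc x 1)}

/-- The success probabilities of the arms, when Nature has picked `θ` for the right arm. -/
def successProb (p θ : ℝ) : Arm → ℝ
  | .left => p
  | .right => θ

/-- Probability of the bit `b` under the Bernoulli law with success probability `q`. -/
def bernoulliWeight (q : ℝ) (b : Bool) : ℝ := if b then q else 1 - q

/-- A table of potential rewards: `X i a t` is the bit that arm `a` holds in row `i` for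
round `t`, where the rounds are `0, …, T`. -/
abbrev RewardTable (ι : Type) (T : ℕ) : Type := ι → Arm → Fin (T + 1) → Bool

/-- Given `θ`, all bits of the table are independent, with the success probabilities of their
arms. -/
def tableWeight {ι : Type} [Fintype ι] {T : ℕ} (p θ : ℝ) (X : RewardTable ι T) : ℝ :=
  ∏ i, ∏ a, ∏ t, bernoulliWeight (successProb p θ a) (X i a t)

/-- Expectation of a function of the reward table, when `θ` is drawn from the prior `μ`. -/
def tableExp {ι : Type} [Fintype ι] [DecidableEq ι] {T : ℕ} (p : ℝ)
    (μ : MeasureTheory.Measure ℝ) (f : RewardTable ι T → ℝ) : ℝ :=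
  ∫ θ, ∑ X : RewardTable ι T, tableWeight p θ X * f X ∂μ

/-- The real value of a reward bit. -/
def bitValue (b : Bool) : ℝ := if b then 1 else 0

/-! ### The game with two players -/

/-- A pure strategy: in each round `t ≤ T` it picks an arm from the public history (the pairs
of own action and opponent's action in the previous rounds) and the private history (the own
rewards in the previous rounds). -/
abbrev PureStrategy (T : ℕ) : Type :=
  (t : Fin (T + 1)) → (Fin t → Arm × Arm) → (Fin t → Bool) → Arm

/-- A mixed strategy: a probability distribution over the finite set of pure strategies. -/
abbrev MixedStrategy (T : ℕ) : Type := stdSimplex ℝ (PureStrategy T)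

/-- Whether two players who pull the same arm in the same round receive one common draw of
that arm or two separate draws (independent given the success probability of the arm). -/
inductive DrawRule
  | common
  | separate

/-- The row of the reward table from which a player's rewards are read. -/
def DrawRule.row : DrawRule → Player → Player
  | .common, _ => .alice
  | .separate, i => i

/-- The arm pulled by player `i` in round `t` under the pure strategies `S`, on the reward
table `X`. -/
def action {T : ℕ} (d : DrawRule) (S : Player → PureStrategy T) (X : RewardTable Player T)
    (i : Player) (t : Fin (T + 1)) : Arm :=
  S i t
    (fun s => (action d S X i ⟨s, s.2.trans t.2⟩, action d S X i.other ⟨s, s.2.trans t.2⟩))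
    (fun s => X (d.row i) (action d S X i ⟨s, s.2.trans t.2⟩) ⟨s, s.2.trans t.2⟩)
termination_by t.val
decreasing_by all_goals exact s.2

/-- The reward of player `i` in round `t`. -/
def reward {T : ℕ} (d : DrawRule) (S : Player → PureStrategy T) (X : RewardTable Player T)
    (i : Player) (t : Fin (T + 1)) : ℝ :=
  bitValue (X (d.row i) (action d S X i t) t)

/-- The total reward of player `i`. -/
def totalReward {T : ℕ} (d : DrawRule) (S : Player → PureStrategy T)
    (X : RewardTable Player T) (i : Player) : ℝ :=
  ∑ t, reward d S X i t

/-- The utility of player `i` with cooperation parameter `lam`: own total reward plus `lam`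
times the opponent's total reward. -/
def utility {T : ℕ} (lam : ℝ) (d : DrawRule) (S : Player → PureStrategy T)
    (X : RewardTable Player T) (i : Player) : ℝ :=
  totalReward d S X i + lam * totalReward d S X i.other

/-- The pair of pure strategies in which Alice uses `a` and Bob uses `b`. -/
def profile {T : ℕ} (a b : PureStrategy T) : Player → PureStrategy T
  | .alice => a
  | .bob => b

/-- Expectation of a function of the played pure strategies and of the reward table, when
Alice and Bob independently randomize by `σA` and `σB`. -/
def gameExp {T : ℕ} (p : ℝ) (μ : MeasureTheory.Measure ℝ) (σA σB : MixedStrategy T)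
    (f : (Player → PureStrategy T) → RewardTable Player T → ℝ) : ℝ :=
  ∑ a : PureStrategy T, ∑ b : PureStrategy T,
    σA.1 a * σB.1 b * tableExp p μ (f (profile a b))

/-- The expected utility of player `i`. -/
def expUtility {T : ℕ} (lam : ℝ) (d : DrawRule) (p : ℝ) (μ : MeasureTheory.Measure ℝ)
    (σA σB : MixedStrategy T) (i : Player) : ℝ :=
  gameExp p μ σA σB (fun S X => utility lam d S X i)

/-- Nash equilibrium: each player's strategy is a best response to the other's. -/
def IsNash {T : ℕ} (lam : ℝ) (d : DrawRule) (p : ℝ) (μ : MeasureTheory.Measure ℝ)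
    (σA σB : MixedStrategy T) : Prop :=
  (∀ τ : MixedStrategy T,
      expUtility lam d p μ τ σB .alice ≤ expUtility lam d p μ σA σB .alice) ∧
    ∀ τ : MixedStrategy T,
      expUtility lam d p μ σA τ .bob ≤ expUtility lam d p μ σA σB .bob

open Classical in
/-- The probability that at least one of the players pulls the right arm at least once. -/
def exploreProb {T : ℕ} (d : DrawRule) (p : ℝ) (μ : MeasureTheory.Measure ℝ)
    (σA σB : MixedStrategy T) : ℝ :=
  gameExp p μ σA σB
    (fun S X => if ∃ (i : Player) (t : Fin (T + 1)), action d S X i t = .right then 1 else 0)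

/-! ### A single player -/

/-- A pure strategy of a single player: it picks an arm from the own past actions and
rewards. -/
abbrev SoloStrategy (T : ℕ) : Type :=
  (t : Fin (T + 1)) → (Fin t → Arm) → (Fin t → Bool) → Arm

/-- A mixed strategy of a single player. -/
abbrev SoloMixed (T : ℕ) : Type := stdSimplex ℝ (SoloStrategy T)

/-- The arm pulled in round `t` by a single player with the pure strategy `S`. -/
def soloAction {T : ℕ} (S : SoloStrategy T) (X : RewardTable Unit T) (t : Fin (T + 1)) : Arm :=
  S t (fun s => soloAction S X ⟨s, s.2.trans t.2⟩)
    (fun s => X () (soloAction S X ⟨s, s.2.trans t.2⟩) ⟨s, s.2.trans t.2⟩)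
termination_by t.val
decreasing_by all_goals exact s.2

/-- The expected total reward of a single player. -/
def soloExpReward {T : ℕ} (p : ℝ) (μ : MeasureTheory.Measure ℝ) (σ : SoloMixed T) : ℝ :=
  ∑ S : SoloStrategy T, σ.1 S *
    tableExp p μ (fun X : RewardTable Unit T => ∑ t, bitValue (X () (soloAction S X t) t))

/-- A strategy of a single player is optimal if it maximizes the expected total reward. -/
def IsSoloOptimal {T : ℕ} (p : ℝ) (μ : MeasureTheory.Measure ℝ) (σ : SoloMixed T) : Prop :=
  ∀ τ : SoloMixed T, soloExpReward p μ τ ≤ soloExpReward p μ σ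

open Classical in
/-- The probability that a single player pulls the right arm at least once. -/
def soloExploreProb {T : ℕ} (p : ℝ) (μ : MeasureTheory.Measure ℝ) (σ : SoloMixed T) : ℝ :=
  ∑ S : SoloStrategy T, σ.1 S *
    tableExp p μ (fun X : RewardTable Unit T =>
      if ∃ t : Fin (T + 1), soloAction S X t = .right then 1 else 0)

end

open MeasureTheory

noncomputable section

/-! ### Expectation over the reward table for a fixed success probability -/

/-! Part 1. The wary copycat repeats the opponent's previous action, but ignores the opponent's
first exploration. Against it, the lead of an exploring opponent telescopes
(`sum_sub_of_waryCopycat`): the one uncopied pull contributes `θ - p`, and of all later pulls only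
the last is unanswered, worth at most `max M* p - p`. Until someone explores, everything observed
comes from left bits, so the event of exploration is independent of `θ` and the first contribution
averages to `m - p`. The expected lead is thus at most `c` times the probability of exploration,
where `c = m - p + (max M* p - p)` is negative when `p > (m + M*) / 2`.

In an equilibrium either player may deviate to the copycat. Adding the two inequalities of this
zero-sum game gives `0 ≤ c * (P + P')`, where `P` and `P'` are the probabilities of exploration when
one of the two strategies meets the copycat; both vanish. Two strategies that do not explore against
the copycat do not explore against each other either (`explores_profile_le`), because without
exploration all plays look alike.

Part 2. For large `N`, `g = ∫ θ ^ N * (θ - p)` is positive: the mass near `M*` dominates. Trying the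
right arm `N` times and keeping it only after `N` successes gains `g` in each later round, at a
trial cost independent of `T`. A strategy that never explores earns just `p` per round, so it is
beaten over a long horizon. -/

theorem bernoulliWeight_nonneg {q : ℝ} (hq : q ∈ Set.Icc (0 : ℝ) 1) (b : Bool) :
    0 ≤ bernoulliWeight q b := by
  unfold bernoulliWeight
  split_ifs
  · exact hq.1
  · linarith [hq.2]

theorem sum_bernoulliWeight (q : ℝ) : ∑ b, bernoulliWeight q b = 1 := by
  simp [bernoulliWeight]

theorem successProb_mem {p θ : ℝ} (hp : p ∈ Set.Icc (0 : ℝ) 1) (hθ : θ ∈ Set.Icc (0 : ℝ) 1)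
    (a : Arm) : successProb p θ a ∈ Set.Icc (0 : ℝ) 1 := by
  cases a <;> assumption

section Table

variable {ι : Type} [Fintype ι] [DecidableEq ι] {T : ℕ}

/-- Expectation of a function of the reward table, given the success probability `θ`. -/
def condTableExp (p θ : ℝ) (f : RewardTable ι T → ℝ) : ℝ :=
  ∑ X : RewardTable ι T, tableWeight p θ X * f X

theorem tableExp_eq (p : ℝ) (μ : Measure ℝ) (f : RewardTable ι T → ℝ) :
    tableExp p μ f = ∫ θ, condTableExp p θ f ∂μ := rfl

omit [DecidableEq ι] in
theorem tableWeight_nonneg {p θ : ℝ} (hp : p ∈ Set.Icc (0 : ℝ) 1)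
    (hθ : θ ∈ Set.Icc (0 : ℝ) 1) (X : RewardTable ι T) : 0 ≤ tableWeight p θ X :=
  Finset.prod_nonneg fun _ _ => Finset.prod_nonneg fun a _ => Finset.prod_nonneg fun _ _ =>
    bernoulliWeight_nonneg (successProb_mem hp hθ a) _

theorem condTableExp_mono {p θ : ℝ} (hp : p ∈ Set.Icc (0 : ℝ) 1)
    (hθ : θ ∈ Set.Icc (0 : ℝ) 1) {f g : RewardTable ι T → ℝ} (h : ∀ X, f X ≤ g X) :
    condTableExp p θ f ≤ condTableExp p θ g :=
  Finset.sum_le_sum fun X _ => mul_le_mul_of_nonneg_left (h X) (tableWeight_nonneg hp hθ X)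

theorem condTableExp_add (p θ : ℝ) (f g : RewardTable ι T → ℝ) :
    condTableExp p θ (fun X => f X + g X) = condTableExp p θ f + condTableExp p θ g := by
  simp [condTableExp, mul_add, Finset.sum_add_distrib]

theorem condTableExp_const_mul (p θ c : ℝ) (f : RewardTable ι T → ℝ) :
    condTableExp p θ (fun X => c * f X) = c * condTableExp p θ f := by
  simp only [condTableExp, Finset.mul_sum]
  exact Finset.sum_congr rfl fun X _ => by ring

theorem condTableExp_sum {κ : Type} (s : Finset κ) (p θ : ℝ) (f : κ → RewardTable ι T → ℝ) :
    condTableExp p θ (fun X => ∑ k ∈ s, f k X) = ∑ k ∈ s, condTableExp p θ (f k) := by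
  simp only [condTableExp, Finset.mul_sum]
  exact Finset.sum_comm

/-- The table in which the bit of arm `a` in row `i` for round `t` is flipped. -/
def flipBit (X : RewardTable ι T) (i : ι) (a : Arm) (t : Fin (T + 1)) : RewardTable ι T :=
  fun i' a' t' => if i' = i ∧ a' = a ∧ t' = t then !X i' a' t' else X i' a' t'

omit [Fintype ι] in
theorem flipBit_flipBit (X : RewardTable ι T) (i : ι) (a : Arm) (t : Fin (T + 1)) :
    flipBit (flipBit X i a t) i a t = X := by
  funext i' a' t'
  by_cases h : i' = i ∧ a' = a ∧ t' = t <;> simp [flipBit, h]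

omit [Fintype ι] in
theorem flipBit_self (X : RewardTable ι T) (i : ι) (a : Arm) (t : Fin (T + 1)) :
    flipBit X i a t i a t = !X i a t := by
  simp [flipBit]

omit [Fintype ι] in
theorem flipBit_of_ne_round (X : RewardTable ι T) (i : ι) (a : Arm) {s t : Fin (T + 1)}
    (h : s ≠ t) (i' : ι) (a' : Arm) : flipBit X i a t i' a' s = X i' a' s := by
  simp [flipBit, h]

theorem tableWeight_eq_mul_prod_erase (p θ : ℝ) (X : RewardTable ι T) (i : ι) (a : Arm)
    (t : Fin (T + 1)) :
    tableWeight p θ X = bernoulliWeight (successProb p θ a) (X i a t) *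
      ∏ x ∈ Finset.univ.erase (i, a, t),
        bernoulliWeight (successProb p θ x.2.1) (X x.1 x.2.1 x.2.2) := by
  rw [Finset.mul_prod_erase Finset.univ
    (fun x : ι × Arm × Fin (T + 1) =>
      bernoulliWeight (successProb p θ x.2.1) (X x.1 x.2.1 x.2.2)) (Finset.mem_univ (i, a, t))]
  simp only [tableWeight, Fintype.prod_prod_type]

/-- A bit is independent of every function of the other bits. -/
theorem condTableExp_mul_bitValue (p θ : ℝ) (f : RewardTable ι T → ℝ) (i : ι) (a : Arm)
    (t : Fin (T + 1)) (hf : ∀ X, f (flipBit X i a t) = f X) :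
    condTableExp p θ (fun X => f X * bitValue (X i a t)) =
      successProb p θ a * condTableExp p θ f := by
  rw [← sub_eq_zero, condTableExp, condTableExp, Finset.mul_sum, ← Finset.sum_sub_distrib]
  -- Flipping the bit pairs the tables. With `q` the success probability, the terms of a pair are `q
  -- * (1 - q)` and its negative, times a common factor.
  refine Finset.sum_involution (fun X _ => flipBit X i a t) ?_ ?_ (fun _ _ => Finset.mem_univ _)
    (fun X _ => flipBit_flipBit X i a t)
  · intro X _
    have hR : ∏ x ∈ Finset.univ.erase (i, a, t),
        bernoulliWeight (successProb p θ x.2.1) (flipBit X i a t x.1 x.2.1 x.2.2) =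
        ∏ x ∈ Finset.univ.erase (i, a, t),
        bernoulliWeight (successProb p θ x.2.1) (X x.1 x.2.1 x.2.2) := by
      refine Finset.prod_congr rfl fun x hx => ?_
      have : ¬(x.1 = i ∧ x.2.1 = a ∧ x.2.2 = t) := fun h =>
        Finset.ne_of_mem_erase hx (Prod.ext h.1 (Prod.ext h.2.1 h.2.2))
      simp only [flipBit, if_neg this]
    rw [tableWeight_eq_mul_prod_erase p θ X i a t,
      tableWeight_eq_mul_prod_erase p θ (flipBit X i a t) i a t, hR, hf, flipBit_self]
    cases X i a t <;> simp [bernoulliWeight, bitValue] <;> ring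
  · intro X _ _ h
    have := congrFun (congrFun (congrFun h i) a) t
    rw [flipBit_self] at this
    simp at this

/-- The expected reward of an arm that is chosen before the round. -/
theorem condTableExp_bitValue_choice (p θ : ℝ) (c : RewardTable ι T → Arm) (i : ι)
    (t : Fin (T + 1)) (hc : ∀ X a, c (flipBit X i a t) = c X) :
    condTableExp p θ (fun X => bitValue (X i (c X) t)) =
      condTableExp p θ (fun X => successProb p θ (c X)) := by
  -- Splitting by the value of the choice reduces the claim to a fixed arm, with an indicator that
  -- ignores the flipped bits.
  have key : ∀ F : RewardTable ι T → Arm → ℝ,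
      condTableExp p θ (fun X => F X (c X)) =
        ∑ a, condTableExp p θ (fun X => (if c X = a then 1 else 0) * F X a) := by
    intro F
    rw [← condTableExp_sum]
    congr 1
    funext X
    simp
  rw [key (fun X a => bitValue (X i a t)), key (fun X a => successProb p θ a)]
  refine Finset.sum_congr rfl fun a _ => ?_
  rw [condTableExp_mul_bitValue p θ (fun X => if c X = a then 1 else 0) i a t
    (fun X => by simp only [hc]), ← condTableExp_const_mul]
  congr 1
  funext X
  ring

/-- A table consists of the bits of the left arm and those of the right arm. -/
def splitTable : RewardTable ι T ≃ (ι → Fin (T + 1) → Bool) × (ι → Fin (T + 1) → Bool) where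
  toFun X := (fun i t => X i .left t, fun i t => X i .right t)
  invFun Y := fun i a t => match a with
    | .left => Y.1 i t
    | .right => Y.2 i t
  left_inv X := by
    funext i a t
    cases a <;> rfl
  right_inv _ := rfl

theorem sum_prod_of_sum_eq_one {κ A : Type} [Fintype κ] [DecidableEq κ] [Fintype A] {g : A → ℝ}
    (hg : ∑ y, g y = 1) : ∑ Y : κ → A, ∏ k, g (Y k) = 1 := by
  classical
  rw [← Fintype.piFinset_univ, ← Finset.prod_univ_sum (fun _ => Finset.univ) (fun _ => g)]
  simp [hg]

theorem sum_prod_bernoulliWeight (q : ℝ) :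
    ∑ Y : ι → Fin (T + 1) → Bool, ∏ i, ∏ t, bernoulliWeight q (Y i t) = 1 :=
  sum_prod_of_sum_eq_one (g := fun y : Fin (T + 1) → Bool => ∏ t, bernoulliWeight q (y t))
    (sum_prod_of_sum_eq_one (sum_bernoulliWeight q))

/-- The right bits sum out to total mass one. The second `Y` in the table is an arbitrary filler for
them; what matters is that `θ` is absent from the right-hand side. -/
theorem condTableExp_eq_sum_left (p θ : ℝ) (f : RewardTable ι T → ℝ)
    (hf : ∀ X Y, (∀ i t, X i .left t = Y i .left t) → f X = f Y) :
    condTableExp p θ f = ∑ Y : ι → Fin (T + 1) → Bool,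
      (∏ i, ∏ t, bernoulliWeight p (Y i t)) * f (splitTable.symm (Y, Y)) := by
  have huniv : (Finset.univ : Finset Arm) = {.left, .right} := rfl
  rw [condTableExp, ← Equiv.sum_comp splitTable.symm, Fintype.sum_prod_type]
  refine Finset.sum_congr rfl fun Y _ => ?_
  have hw : ∀ Z : ι → Fin (T + 1) → Bool, tableWeight p θ (splitTable.symm (Y, Z)) =
      (∏ i, ∏ t, bernoulliWeight p (Y i t)) * ∏ i, ∏ t, bernoulliWeight θ (Z i t) := by
    intro Z
    rw [tableWeight, ← Finset.prod_mul_distrib]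
    refine Finset.prod_congr rfl fun i _ => ?_
    rw [huniv, Finset.prod_pair (by decide)]
    rfl
  have hc : ∀ Z, f (splitTable.symm (Y, Z)) = f (splitTable.symm (Y, Y)) :=
    fun Z => hf _ _ fun _ _ => rfl
  simp only [hw, hc]
  rw [← Finset.sum_mul, ← Finset.mul_sum, sum_prod_bernoulliWeight, mul_one]

/-- The expectation of a function of the left bits does not depend on `θ`. -/
theorem condTableExp_eq_of_left (p θ θ' : ℝ) (f : RewardTable ι T → ℝ)
    (hf : ∀ X Y, (∀ i t, X i .left t = Y i .left t) → f X = f Y) :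
    condTableExp p θ f = condTableExp p θ' f := by
  rw [condTableExp_eq_sum_left p θ f hf, condTableExp_eq_sum_left p θ' f hf]

theorem condTableExp_const (p θ c : ℝ) :
    condTableExp p θ (fun _ : RewardTable ι T => c) = c := by
  rw [condTableExp_eq_sum_left p θ _ fun _ _ _ => rfl, ← Finset.sum_mul,
    sum_prod_bernoulliWeight, one_mul]

/-- The first `N` pulls of the right arm are all successful with probability `θ ^ N`. -/
theorem condTableExp_prod_bitValue (p θ : ℝ) (i : ι) {N : ℕ} (hN : N ≤ T + 1) :
    condTableExp p θ (fun X : RewardTable ι T =>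
      ∏ s : Fin N, bitValue (X i .right ⟨s, s.2.trans_le hN⟩)) = θ ^ N := by
  induction N with
  | zero => simpa using condTableExp_const p θ 1
  | succ N ih =>
    simp only [Fin.prod_univ_castSucc]
    rw [pow_succ', ← ih (by omega)]
    refine condTableExp_mul_bitValue p θ (fun X : RewardTable ι T =>
      ∏ s : Fin N, bitValue (X i .right ⟨s, s.2.trans_le (by omega)⟩)) i .right ⟨N, by omega⟩ ?_
    intro X
    refine Finset.prod_congr rfl fun s _ => ?_
    rw [flipBit_of_ne_round]
    intro h
    have := congrArg Fin.val h
    have := s.2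
    simp at *
    omega

theorem continuous_condTableExp (p : ℝ) (F : ℝ → RewardTable ι T → ℝ)
    (hF : ∀ X, Continuous fun θ => F θ X) : Continuous fun θ => condTableExp p θ (F θ) := by
  refine continuous_finsetSum _ fun X _ => Continuous.mul ?_ (hF X)
  refine continuous_finsetProd _ fun i _ => continuous_finsetProd _ fun a _ =>
    continuous_finsetProd _ fun t _ => ?_
  cases a <;> cases X i _ t <;> simp [successProb, bernoulliWeight] <;> fun_prop

end Table

/-! ### Integration against the prior -/

section Prior

variable {μ : Measure ℝ} [IsProbabilityMeasure μ]

theorem ae_mem_Icc (hμ : μ (Set.Icc (0 : ℝ) 1) = 1) : ∀ᵐ θ ∂μ, θ ∈ Set.Icc (0 : ℝ) 1 := by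
  exact (mem_ae_iff_prob_eq_one measurableSet_Icc).2 hμ

theorem integrable_of_continuous (hμ : μ (Set.Icc (0 : ℝ) 1) = 1) {f : ℝ → ℝ}
    (hf : Continuous f) : Integrable f μ := by
  rw [← Measure.restrict_eq_self_of_ae_mem (ae_mem_Icc hμ)]
  exact hf.continuousOn.integrableOn_compact isCompact_Icc

omit [IsProbabilityMeasure μ] in
theorem bddAbove_priorMax_set :
    BddAbove {x : ℝ | x ∈ Set.Icc (0 : ℝ) 1 ∧ 0 < μ (Set.Ioc x 1)} :=
  ⟨1, fun _ hx => hx.1.2⟩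

omit [IsProbabilityMeasure μ] in
theorem priorMax_nonneg : 0 ≤ priorMax μ := Real.sSup_nonneg fun _ hx => hx.1.1

/-- Any interval `(M* + 1/(n+1), 1]` of positive mass would put its left end into the set whose
supremum is `M*`. Countably many null intervals cover everything in `[0, 1]` above `M*`. -/
theorem ae_le_priorMax (hμ : μ (Set.Icc (0 : ℝ) 1) = 1) : ∀ᵐ θ ∂μ, θ ≤ priorMax μ := by
  have h : ∀ n : ℕ, ∀ᵐ θ ∂μ, ¬ θ ∈ Set.Ioc (priorMax μ + 1 / ((n : ℝ) + 1)) 1 := by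
    intro n
    have hn : (0 : ℝ) < 1 / ((n : ℝ) + 1) := Nat.one_div_pos_of_nat
    rw [← measure_eq_zero_iff_ae_notMem]
    by_contra hne
    have hlt : priorMax μ + 1 / ((n : ℝ) + 1) < 1 := by
      by_contra hge
      rw [Set.Ioc_eq_empty (by linarith)] at hne
      simp at hne
    have hmem : priorMax μ + 1 / ((n : ℝ) + 1) ∈
        {x : ℝ | x ∈ Set.Icc (0 : ℝ) 1 ∧ 0 < μ (Set.Ioc x 1)} :=
      ⟨⟨by linarith [priorMax_nonneg (μ := μ)], hlt.le⟩, pos_iff_ne_zero.2 hne⟩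
    have : _ ≤ priorMax μ := le_csSup bddAbove_priorMax_set hmem
    linarith
  filter_upwards [ae_all_iff.2 h, ae_mem_Icc hμ] with θ hθ hθ1
  by_contra! hlt
  obtain ⟨n, hn⟩ := exists_nat_one_div_lt (sub_pos.2 hlt)
  exact hθ n ⟨by linarith, hθ1.2⟩

theorem priorMean_le_priorMax (hμ : μ (Set.Icc (0 : ℝ) 1) = 1) : priorMean μ ≤ priorMax μ := by
  have := integral_mono_ae (integrable_of_continuous hμ continuous_id)
    (integrable_const (priorMax μ)) (ae_le_priorMax hμ)
  simpa [priorMean] using this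

/-- If `p` is below the maximum of the support, then a long enough run of successes makes the
right arm attractive. -/
theorem exists_pow_integral_pos (hμ : μ (Set.Icc (0 : ℝ) 1) = 1) {p : ℝ} (hp : 0 ≤ p)
    (hp1 : p ≤ 1) (h : p < priorMax μ) : ∃ N : ℕ, 0 < ∫ θ, θ ^ N * (θ - p) ∂μ := by
  have hne : {x : ℝ | x ∈ Set.Icc (0 : ℝ) 1 ∧ 0 < μ (Set.Ioc x 1)}.Nonempty := by
    -- For a prior without mass on `(0, 1]` the set is empty and its real supremum is the default
    -- `0`, which no `p ≥ 0` lies below.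
    by_contra hE
    rw [Set.not_nonempty_iff_eq_empty] at hE
    rw [priorMax, hE, Real.sSup_empty] at h
    linarith
  obtain ⟨c, ⟨-, hcμ⟩, hpc⟩ := exists_lt_of_lt_csSup hne h
  have hc : 0 < c := hp.trans_lt hpc
  set δ := μ.real (Set.Ioc c 1) with hδ
  have hδ0 : 0 < δ := ENNReal.toReal_pos hcμ.ne' (measure_ne_top _ _)
  -- This choice means `p ^ N < c ^ N * (c - p) * δ`: the gain on `(c, 1]` exceeds the largest
  -- possible loss below `p`.
  obtain ⟨N, hN⟩ := exists_pow_lt_of_lt_one (mul_pos (sub_pos.2 hpc) hδ0)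
    ((div_lt_one hc).2 hpc)
  rw [div_pow, div_lt_iff₀ (by positivity)] at hN
  refine ⟨N, ?_⟩
  have hi1 : Integrable ((Set.Ioc c 1).indicator fun _ : ℝ => c ^ N * (c - p)) μ :=
    (integrable_const _).indicator measurableSet_Ioc
  have hmono : ∫ θ, ((Set.Ioc c 1).indicator (fun _ : ℝ => c ^ N * (c - p)) θ - p ^ N) ∂μ ≤
      ∫ θ, θ ^ N * (θ - p) ∂μ := by
    refine integral_mono_ae (hi1.sub (integrable_const _))
      (integrable_of_continuous hμ (by fun_prop)) ?_
    filter_upwards [ae_mem_Icc hμ] with θ hθ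
    have hpN : 0 ≤ p ^ N := by positivity
    by_cases hcθ : c < θ
    · rw [Set.indicator_of_mem (Set.mem_Ioc.2 ⟨hcθ, hθ.2⟩)]
      have h1 : c ^ N * (c - p) ≤ θ ^ N * (θ - p) := by
        have := sub_pos.2 hpc
        have := pow_nonneg hθ.1 N
        gcongr
      linarith
    · rw [Set.indicator_of_notMem fun hh => hcθ hh.1]
      by_cases hθp : p ≤ θ
      · have : 0 ≤ θ ^ N * (θ - p) := mul_nonneg (pow_nonneg hθ.1 _) (by linarith)
        linarith
      · have h1 : θ ^ N ≤ p ^ N := pow_le_pow_left₀ hθ.1 (by linarith) N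
        have h2 : θ ^ N * (p - θ) ≤ p ^ N * 1 :=
          mul_le_mul h1 (by linarith [hθ.1]) (by linarith) hpN
        linarith
  rw [integral_sub hi1 (integrable_const _), integral_indicator_const _ measurableSet_Ioc] at hmono
  simp only [integral_const, probReal_univ, smul_eq_mul, one_mul, ← hδ] at hmono
  nlinarith

/-! ### Expectation over the table and the prior -/

section TableExp

variable {ι : Type} [Fintype ι] [DecidableEq ι] {T : ℕ} {p : ℝ}

theorem integrable_condTableExp (hμ : μ (Set.Icc (0 : ℝ) 1) = 1) (f : RewardTable ι T → ℝ) :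
    Integrable (fun θ => condTableExp p θ f) μ :=
  integrable_of_continuous hμ (continuous_condTableExp p (fun _ => f) fun _ => continuous_const)

theorem tableExp_mono (hμ : μ (Set.Icc (0 : ℝ) 1) = 1) (hp : p ∈ Set.Icc (0 : ℝ) 1)
    {f g : RewardTable ι T → ℝ} (h : ∀ X, f X ≤ g X) : tableExp p μ f ≤ tableExp p μ g := by
  refine integral_mono_ae (integrable_condTableExp hμ f) (integrable_condTableExp hμ g) ?_
  filter_upwards [ae_mem_Icc hμ] with θ hθ
  exact condTableExp_mono hp hθ h

theorem tableExp_nonneg (hμ : μ (Set.Icc (0 : ℝ) 1) = 1) (hp : p ∈ Set.Icc (0 : ℝ) 1)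
    {f : RewardTable ι T → ℝ} (h : ∀ X, 0 ≤ f X) : 0 ≤ tableExp p μ f := by
  refine integral_nonneg_of_ae ?_
  filter_upwards [ae_mem_Icc hμ] with θ hθ
  exact Finset.sum_nonneg fun X _ => mul_nonneg (tableWeight_nonneg hp hθ X) (h X)

theorem tableExp_add (hμ : μ (Set.Icc (0 : ℝ) 1) = 1) (f g : RewardTable ι T → ℝ) :
    tableExp p μ (fun X => f X + g X) = tableExp p μ f + tableExp p μ g := by
  simp only [tableExp_eq, condTableExp_add]
  exact integral_add (integrable_condTableExp hμ f) (integrable_condTableExp hμ g)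

end TableExp

end Prior

/-! ### Causality of the play -/

section Game

variable {T : ℕ} (d : DrawRule)

theorem Player.other_other (i : Player) : i.other.other = i := by
  cases i <;> rfl

/-- The arm pulled in round `t` depends only on the bits of the previous rounds. -/
theorem action_congr (S : Player → PureStrategy T) {X Y : RewardTable Player T}
    (t : Fin (T + 1)) (h : ∀ i a s, s < t → X i a s = Y i a s) (i : Player) :
    action d S X i t = action d S Y i t := by
  induction t using WellFoundedLT.induction generalizing i with
  | ind t ih =>
    have hact : ∀ j (s : Fin t), action d S X j ⟨s, s.2.trans t.2⟩ =
        action d S Y j ⟨s, s.2.trans t.2⟩ := fun j s =>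
      ih ⟨s, s.2.trans t.2⟩ s.2 (fun i a r hr => h i a r (hr.trans s.2)) j
    rw [action, action]
    simp only [hact]
    congr 1
    funext s
    exact h _ _ _ s.2

theorem action_flipBit (S : Player → PureStrategy T) (X : RewardTable Player T) (i j : Player)
    (a : Arm) (t : Fin (T + 1)) : action d S (flipBit X j a t) i t = action d S X i t :=
  action_congr d S t (fun _ _ _ hs => flipBit_of_ne_round X j a hs.ne _ _) i

/-- If each player uses a strategy that does not explore in some play with the same left bits,
then nobody explores. -/
theorem action_eq_left_of_forall {S : Player → PureStrategy T} {X : RewardTable Player T}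
    (h : ∀ i, ∃ (S' : Player → PureStrategy T) (X' : RewardTable Player T), S' i = S i ∧
      (∀ j t, X' j .left t = X j .left t) ∧ ∀ j t, action d S' X' j t = .left)
    (i : Player) (t : Fin (T + 1)) : action d S X i t = .left := by
  induction t using WellFoundedLT.induction generalizing i with
  | ind t ih =>
    obtain ⟨S', X', hS, hX, hleft⟩ := h i
    have hact : ∀ j (s : Fin t), action d S X j ⟨s, s.2.trans t.2⟩ = .left := fun j s =>
      ih ⟨s, s.2.trans t.2⟩ s.2 j
    -- The reference play shows player `i` the same history: only left pulls so far, with the same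
    -- left bits.
    have ht := hleft i t
    rw [action] at ht ⊢
    simp only [hact]
    simpa only [hleft, hS, hX] using ht

open Classical in
/-- The indicator of the event that at least one of the players explores. -/
def explores (S : Player → PureStrategy T) (X : RewardTable Player T) : ℝ :=
  if ∃ (i : Player) (t : Fin (T + 1)), action d S X i t = .right then 1 else 0

theorem Arm.ne_right_iff {a : Arm} : a ≠ .right ↔ a = .left := by
  cases a <;> decide

theorem explores_nonneg (S : Player → PureStrategy T) (X : RewardTable Player T) :
    0 ≤ explores d S X := by
  unfold explores
  split_ifs <;> norm_num

theorem explores_eq_zero {S : Player → PureStrategy T} {X : RewardTable Player T}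
    (h : ∀ i t, action d S X i t = .left) : explores d S X = 0 := by
  simp [explores, h]

theorem explores_eq_zero_or_one (S : Player → PureStrategy T) (X : RewardTable Player T) :
    (∀ i t, action d S X i t = .left) ∧ explores d S X = 0 ∨ explores d S X = 1 := by
  by_cases h : ∃ (i : Player) (t : Fin (T + 1)), action d S X i t = .right
  · exact .inr (if_pos h)
  · refine .inl ⟨fun i t => ?_, if_neg h⟩
    push Not at h
    exact Arm.ne_right_iff.1 (h i t)

/-- Up to the first exploration only left bits have been observed, so they alone decide whether it
occurs. This makes exploration independent of `θ`. -/
theorem explores_congr_left (S : Player → PureStrategy T) (X Y : RewardTable Player T)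
    (h : ∀ i t, X i .left t = Y i .left t) : explores d S X = explores d S Y := by
  rcases explores_eq_zero_or_one d S X with ⟨hX, hX0⟩ | hX
  · rw [hX0, explores_eq_zero d (action_eq_left_of_forall d fun _ => ⟨S, X, rfl, h, hX⟩)]
  · rcases explores_eq_zero_or_one d S Y with ⟨hY, hY0⟩ | hY
    · rw [hY0, explores_eq_zero d
        (action_eq_left_of_forall d fun _ => ⟨S, Y, rfl, fun i t => (h i t).symm, hY⟩)]
    · rw [hX, hY]

/-- If `a` meets `c` and `c'` meets `b` without exploration, then `a` and `b` each stay left on the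
all-left history, hence also against each other. It is used with the copycat as `c` and `c'`. -/
theorem explores_profile_le (a b c c' : PureStrategy T) (X : RewardTable Player T) :
    explores d (profile a b) X ≤ explores d (profile a c) X + explores d (profile c' b) X := by
  rcases explores_eq_zero_or_one d (profile a c) X with ⟨hA, hA0⟩ | hA
  · rcases explores_eq_zero_or_one d (profile c' b) X with ⟨hB, hB0⟩ | hB
    · rw [hA0, hB0, explores_eq_zero d (action_eq_left_of_forall d fun i => ?_), add_zero]
      cases i
      · exact ⟨profile a c, X, rfl, fun _ _ => rfl, hA⟩
      · exact ⟨profile c' b, X, rfl, fun _ _ => rfl, hB⟩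
    · rw [hA0, hB, zero_add]
      rcases explores_eq_zero_or_one d (profile a b) X with ⟨-, h⟩ | h <;> simp [h]
  · rw [hA]
    have := explores_nonneg d (profile c' b) X
    rcases explores_eq_zero_or_one d (profile a b) X with ⟨-, h⟩ | h <;> rw [h] <;> linarith

/-- The action is fixed before the round's bits matter, whichever row holds them; this covers both
draw rules at once. -/
theorem condTableExp_reward (p θ : ℝ) (S : Player → PureStrategy T) (i : Player)
    (t : Fin (T + 1)) :
    condTableExp p θ (fun X => reward d S X i t) =
      condTableExp p θ (fun X => successProb p θ (action d S X i t)) :=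
  condTableExp_bitValue_choice p θ (fun X => action d S X i t) (d.row i) t
    fun X a => action_flipBit d S X i (d.row i) a t

theorem condTableExp_totalReward (p θ : ℝ) (S : Player → PureStrategy T) (i : Player) :
    condTableExp p θ (fun X => totalReward d S X i) =
      condTableExp p θ (fun X => ∑ t, successProb p θ (action d S X i t)) := by
  simp only [totalReward, condTableExp_sum, condTableExp_reward]

/-- Given `θ`, the expected lead of a player is the sum of the differences of the success
probabilities of the arms pulled. -/
theorem condTableExp_utility (p θ : ℝ) (S : Player → PureStrategy T) (i : Player) :
    condTableExp p θ (fun X => utility (-1) d S X i) =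
      condTableExp p θ (fun X => ∑ t, (successProb p θ (action d S X i t) -
        successProb p θ (action d S X i.other t))) := by
  simp only [utility, condTableExp_add, condTableExp_const_mul, condTableExp_totalReward]
  rw [← condTableExp_const_mul, ← condTableExp_add]
  congr 1
  funext X
  rw [Finset.sum_sub_distrib]
  ring

/-! ### The wary copycat -/

/-- The wary copycat copies the opponent's previous action, except that the opponent's first
exploration is not copied. -/
def waryCopycat : PureStrategy T := fun t h _ =>
  if ∃ k : Fin t, k.val + 1 = t ∧ (h k).2 = .right ∧ ∃ s : Fin t, s < k ∧ (h s).2 = .right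
  then .right else .left

open Classical in
/-- The lead over a wary copycat, as a telescoping sum. -/
theorem sum_sub_of_waryCopycat (q : Arm → ℝ) (a b : ℕ → Arm) (h0 : b 0 = .left) (n : ℕ)
    (hb : ∀ k < n, b (k + 1) =
      if a k = .right ∧ ∃ s < k, a s = .right then .right else .left) :
    ∑ s ∈ Finset.range (n + 1), (q (a s) - q (b s)) =
      if ∃ s < n + 1, a s = .right then
        q .right - q .left + if ∃ s < n, a s = .right then q (a n) - q .left else 0
      else 0 := by
  have hlt : ∀ n, (∃ s < n + 1, a s = .right) ↔ (∃ s < n, a s = .right) ∨ a n = .right := by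
    intro n
    simp only [Nat.lt_succ_iff_lt_or_eq, or_and_right, exists_or, exists_eq_left]
  -- After the first exploration has been skipped, `b (k + 1) = a k`. The later differences
  -- therefore collapse to `q (a n) - q .left`, which is absent if the first exploration is in round
  -- `n` itself.
  induction n with
  | zero => cases h : a 0 <;> simp [h0, h]
  | succ n ih =>
    rw [Finset.sum_range_succ, ih fun k hk => hb k (by omega), hb n (by omega)]
    by_cases hE : ∃ s < n, a s = .right <;> cases h : a n <;> cases h' : a (n + 1) <;>
      simp only [hlt, hE, h, h'] <;> (simp; try ring)

theorem sum_action_sub_of_waryCopycat (q : Arm → ℝ) {S : Player → PureStrategy T} {i : Player}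
    (hS : S i.other = waryCopycat) (X : RewardTable Player T) {M : ℝ} (hM : q .left ≤ M)
    (hqM : q .right ≤ M) :
    ∑ t, (q (action d S X i t) - q (action d S X i.other t)) ≤
      explores d S X * (q .right - q .left + (M - q .left)) := by
  classical
  -- The actions are extended by the dummy value `.left` beyond the horizon, so that the sum can run
  -- over natural numbers.
  set act : Player → ℕ → Arm := fun j n =>
    if h : n < T + 1 then action d S X j ⟨n, h⟩ else .left with hact
  have hact' : ∀ j (t : Fin (T + 1)), action d S X j t = act j t := fun j t => by
    simp only [hact, dif_pos t.2]
  have hother : ∀ t : Fin (T + 1), action d S X i.other t =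
      if ∃ k : Fin t, k.val + 1 = t ∧ act i k = .right ∧
        ∃ s : Fin t, s < k ∧ act i s = .right then .right else .left := by
    intro t
    rw [action, hS]
    simp only [waryCopycat, Player.other_other, hact']
  have h0 : act i.other 0 = .left := by
    rw [← Fin.val_zero (T + 1), ← hact', hother, if_neg]
    rintro ⟨k, hk, -⟩
    simp at hk
  have hsucc : ∀ k < T, act i.other (k + 1) =
      if act i k = .right ∧ ∃ s < k, act i s = .right then .right else .left := by
    intro k hk
    have := hother ⟨k + 1, by omega⟩
    rw [hact'] at this
    rw [this]
    refine if_congr ⟨?_, ?_⟩ rfl rfl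
    · rintro ⟨k', hk', h1, s, hs, h2⟩
      have hkk : k'.val = k := by simpa using hk'
      rw [← hkk]
      exact ⟨h1, s, hs, h2⟩
    · rintro ⟨h1, s, hs, h2⟩
      exact ⟨⟨k, by simp⟩, rfl, h1, ⟨s, by simp; omega⟩, hs, h2⟩
  have hsum := sum_sub_of_waryCopycat q (act i) (act i.other) h0 T hsucc
  have hfin : ∑ t, (q (action d S X i t) - q (action d S X i.other t)) =
      ∑ s ∈ Finset.range (T + 1), (q (act i s) - q (act i.other s)) := by
    rw [Finset.sum_range]
    simp only [hact']
  rw [hfin, hsum]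
  by_cases hex : ∃ s < T + 1, act i s = .right
  · have h1 : explores d S X = 1 := by
      obtain ⟨s, hs, hr⟩ := hex
      exact if_pos ⟨i, ⟨s, hs⟩, by rw [hact']; exact hr⟩
    rw [if_pos hex, h1, one_mul]
    split_ifs
    · cases act i T <;> linarith
    · linarith
  · have h1 : explores d S X = 0 := by
      push Not at hex
      have hi : ∀ t, action d S X i t = .left := fun t => by
        rw [hact']
        exact Arm.ne_right_iff.1 (hex t t.2)
      -- The indicator concerns both players, but the copycat never explores on its own.
      refine explores_eq_zero d fun j t => ?_
      have hj : j = i ∨ j = i.other := by cases i <;> cases j <;> simp [Player.other]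
      rcases hj with rfl | rfl
      · exact hi t
      · rw [hother, if_neg]
        rintro ⟨k, -, hk, -⟩
        exact hex k (k.2.trans t.2) hk
    rw [if_neg hex, h1, zero_mul]

/-! ### Mixed strategies and equilibrium -/

variable {μ : Measure ℝ} {p : ℝ}

theorem gameExp_nonneg {σA σB : MixedStrategy T}
    {f : (Player → PureStrategy T) → RewardTable Player T → ℝ}
    (h : ∀ S, 0 ≤ tableExp p μ (f S)) : 0 ≤ gameExp p μ σA σB f :=
  Finset.sum_nonneg fun a _ => Finset.sum_nonneg fun b _ =>
    mul_nonneg (mul_nonneg (σA.2.1 a) (σB.2.1 b)) (h _)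

/-- The mixed strategy that plays the pure strategy `a`. -/
def pureMixed {A : Type} [Fintype A] [DecidableEq A] (a : A) : stdSimplex ℝ A :=
  ⟨Pi.single a 1, single_mem_stdSimplex ℝ a⟩

theorem sum_pureMixed_mul {A : Type} [Fintype A] [DecidableEq A] (a : A) (f : A → ℝ) :
    ∑ b, (pureMixed a).1 b * f b = f a := by
  simp [pureMixed, Pi.single_apply]

theorem gameExp_pureMixed_right (σA : MixedStrategy T) (b : PureStrategy T)
    (f : (Player → PureStrategy T) → RewardTable Player T → ℝ) :
    gameExp p μ σA (pureMixed b) f = ∑ a, σA.1 a * tableExp p μ (f (profile a b)) := by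
  refine Finset.sum_congr rfl fun a _ => ?_
  simp only [mul_assoc]
  rw [← Finset.mul_sum, sum_pureMixed_mul b fun b => tableExp p μ (f (profile a b))]

theorem gameExp_pureMixed_left (a : PureStrategy T) (σB : MixedStrategy T)
    (f : (Player → PureStrategy T) → RewardTable Player T → ℝ) :
    gameExp p μ (pureMixed a) σB f = ∑ b, σB.1 b * tableExp p μ (f (profile a b)) := by
  rw [gameExp, Finset.sum_comm]
  refine Finset.sum_congr rfl fun b _ => ?_
  simp only [mul_comm _ (σB.1 b), mul_assoc]
  rw [← Finset.mul_sum, sum_pureMixed_mul a fun a => tableExp p μ (f (profile a b))]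

theorem utility_bob (S : Player → PureStrategy T) (X : RewardTable Player T) :
    utility (-1) d S X .bob = -utility (-1) d S X .alice := by
  simp only [utility, Player.other]
  ring

theorem tableExp_utility_bob (S : Player → PureStrategy T) :
    tableExp p μ (fun X => utility (-1) d S X .bob) =
      -tableExp p μ (fun X => utility (-1) d S X .alice) := by
  simp only [utility_bob, tableExp, mul_neg, Finset.sum_neg_distrib, integral_neg]

theorem expUtility_bob (σA σB : MixedStrategy T) :
    expUtility (-1) d p μ σA σB .bob = -expUtility (-1) d p μ σA σB .alice := by
  simp only [expUtility, gameExp, tableExp_utility_bob, mul_neg, Finset.sum_neg_distrib]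

theorem exploreProb_eq (σA σB : MixedStrategy T) :
    exploreProb d p μ σA σB = gameExp p μ σA σB (explores d) := rfl

variable [IsProbabilityMeasure μ]

/-- Against a wary copycat, exploration costs at least `p - m` and wins at most `M* - p`. -/
theorem tableExp_utility_le_of_waryCopycat (hμ : μ (Set.Icc (0 : ℝ) 1) = 1)
    (hp : p ∈ Set.Icc (0 : ℝ) 1) {S : Player → PureStrategy T} {i : Player}
    (hS : S i.other = waryCopycat) :
    tableExp p μ (fun X => utility (-1) d S X i) ≤
      (priorMean μ - p + (max (priorMax μ) p - p)) * tableExp p μ (explores d S) := by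
  -- The probability of exploration is the same for all `θ`, so it leaves the integral and `θ`
  -- enters only through its mean.
  have hconst : ∀ θ, condTableExp p θ (explores d S) = condTableExp p 0 (explores d S) :=
    fun θ => condTableExp_eq_of_left p θ 0 _ fun X Y h => explores_congr_left d S X Y h
  have hbound : ∀ᵐ θ ∂μ, condTableExp p θ (fun X => utility (-1) d S X i) ≤
      (θ - p + (max (priorMax μ) p - p)) * condTableExp p 0 (explores d S) := by
    filter_upwards [ae_mem_Icc hμ, ae_le_priorMax hμ] with θ hθ hθM
    rw [condTableExp_utility, ← hconst θ, ← condTableExp_const_mul]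
    refine condTableExp_mono hp hθ fun X => ?_
    rw [mul_comm]
    exact sum_action_sub_of_waryCopycat d (successProb p θ) hS X (le_max_right _ _)
      (hθM.trans (le_max_left _ _))
  have hid : Integrable (fun θ : ℝ => θ) μ := integrable_of_continuous hμ continuous_id
  calc tableExp p μ (fun X => utility (-1) d S X i)
      ≤ ∫ θ, (θ - p + (max (priorMax μ) p - p)) * condTableExp p 0 (explores d S) ∂μ :=
        integral_mono_ae (integrable_condTableExp hμ _)
          (integrable_of_continuous hμ (by fun_prop)) hbound
    _ = _ := by
        rw [integral_mul_const, tableExp_eq]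
        simp only [hconst]
        have hsub : Integrable (fun θ : ℝ => θ - p) μ := hid.sub (integrable_const _)
        rw [integral_add hsub (integrable_const _), integral_sub hid (integrable_const _)]
        simp [priorMean]

theorem tableExp_explores_nonneg (hμ : μ (Set.Icc (0 : ℝ) 1) = 1)
    (hp : p ∈ Set.Icc (0 : ℝ) 1) (S : Player → PureStrategy T) :
    0 ≤ tableExp p μ (explores d S) :=
  tableExp_nonneg hμ hp (explores_nonneg d S)

theorem exploreProb_nonneg (hμ : μ (Set.Icc (0 : ℝ) 1) = 1) (hp : p ∈ Set.Icc (0 : ℝ) 1)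
    (σA σB : MixedStrategy T) : 0 ≤ exploreProb d p μ σA σB :=
  gameExp_nonneg (tableExp_explores_nonneg d hμ hp)

theorem expUtility_alice_le (hμ : μ (Set.Icc (0 : ℝ) 1) = 1) (hp : p ∈ Set.Icc (0 : ℝ) 1)
    (σA : MixedStrategy T) :
    expUtility (-1) d p μ σA (pureMixed waryCopycat) .alice ≤
      (priorMean μ - p + (max (priorMax μ) p - p)) *
        exploreProb d p μ σA (pureMixed waryCopycat) := by
  rw [expUtility, exploreProb_eq, gameExp_pureMixed_right, gameExp_pureMixed_right,
    Finset.mul_sum]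
  refine Finset.sum_le_sum fun a _ => ?_
  rw [mul_left_comm]
  exact mul_le_mul_of_nonneg_left (tableExp_utility_le_of_waryCopycat d hμ hp rfl) (σA.2.1 a)

theorem expUtility_bob_le (hμ : μ (Set.Icc (0 : ℝ) 1) = 1) (hp : p ∈ Set.Icc (0 : ℝ) 1)
    (σB : MixedStrategy T) :
    expUtility (-1) d p μ (pureMixed waryCopycat) σB .bob ≤
      (priorMean μ - p + (max (priorMax μ) p - p)) *
        exploreProb d p μ (pureMixed waryCopycat) σB := by
  rw [expUtility, exploreProb_eq, gameExp_pureMixed_left, gameExp_pureMixed_left,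
    Finset.mul_sum]
  refine Finset.sum_le_sum fun b _ => ?_
  rw [mul_left_comm]
  exact mul_le_mul_of_nonneg_left (tableExp_utility_le_of_waryCopycat d hμ hp rfl) (σB.2.1 b)

theorem exploreProb_le_add (hμ : μ (Set.Icc (0 : ℝ) 1) = 1) (hp : p ∈ Set.Icc (0 : ℝ) 1)
    (σA σB : MixedStrategy T) (a' b' : PureStrategy T) :
    exploreProb d p μ σA σB ≤
      exploreProb d p μ σA (pureMixed b') + exploreProb d p μ (pureMixed a') σB := by
  have hA : ∑ a, ∑ b, σA.1 a * σB.1 b * tableExp p μ (explores d (profile a b')) =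
      ∑ a, σA.1 a * tableExp p μ (explores d (profile a b')) := by
    refine Finset.sum_congr rfl fun a _ => ?_
    rw [← Finset.sum_mul, ← Finset.mul_sum, σB.2.2, mul_one]
  have hB : ∑ a, ∑ b, σA.1 a * σB.1 b * tableExp p μ (explores d (profile a' b)) =
      ∑ b, σB.1 b * tableExp p μ (explores d (profile a' b)) := by
    rw [Finset.sum_comm]
    refine Finset.sum_congr rfl fun b _ => ?_
    rw [← Finset.sum_mul, ← Finset.sum_mul, σA.2.2, one_mul]
  simp only [exploreProb_eq]
  rw [gameExp_pureMixed_right, gameExp_pureMixed_left, ← hA, ← hB, ← Finset.sum_add_distrib]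
  refine Finset.sum_le_sum fun a _ => ?_
  rw [← Finset.sum_add_distrib]
  refine Finset.sum_le_sum fun b _ => ?_
  rw [← mul_add, ← tableExp_add hμ]
  exact mul_le_mul_of_nonneg_left
    (tableExp_mono hμ hp fun X => explores_profile_le d a b b' a' X)
    (mul_nonneg (σA.2.1 a) (σB.2.1 b))

/-- In the zero-sum game with a good predictable arm nobody explores in equilibrium. -/
theorem exploreProb_eq_zero_of_isNash (hμ : μ (Set.Icc (0 : ℝ) 1) = 1)
    (hp : p ∈ Set.Icc (0 : ℝ) 1) (hlt : (priorMean μ + priorMax μ) / 2 < p)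
    {σA σB : MixedStrategy T} (h : IsNash (-1) d p μ σA σB) : exploreProb d p μ σA σB = 0 := by
  have hc : priorMean μ - p + (max (priorMax μ) p - p) < 0 := by
    have := priorMean_le_priorMax hμ
    -- If `M* ≥ p`, the claim is `m + M* < 2 * p`; otherwise it is `m < p`, which follows from `m ≤
    -- M*`.
    rcases max_cases (priorMax μ) p with ⟨h, -⟩ | ⟨h, -⟩ <;> rw [h] <;> linarith
  have h1 := h.1 (pureMixed waryCopycat)
  have h2 := h.2 (pureMixed waryCopycat)
  have h3 := expUtility_alice_le d hμ hp σA
  have h4 := expUtility_bob_le d hμ hp σB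
  simp only [expUtility_bob] at h2 h4
  have hA := exploreProb_nonneg d hμ hp σA (pureMixed waryCopycat)
  have hB := exploreProb_nonneg d hμ hp (pureMixed waryCopycat) σB
  have hle := exploreProb_le_add d hμ hp σA σB waryCopycat waryCopycat
  have hge := exploreProb_nonneg d hμ hp σA σB
  -- Adding the deviations gives `0 ≤ c * (P + P')` with `c < 0`, so `P + P'`, which bounds the
  -- goal, is zero.
  nlinarith

end Game

/-! ### The single player -/

section Solo

variable {T : ℕ} {p : ℝ}

theorem soloAction_congr (S : SoloStrategy T) {X Y : RewardTable Unit T} (t : Fin (T + 1))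
    (h : ∀ i a s, s < t → X i a s = Y i a s) : soloAction S X t = soloAction S Y t := by
  induction t using WellFoundedLT.induction with
  | ind t ih =>
    have hact : ∀ s : Fin t, soloAction S X ⟨s, s.2.trans t.2⟩ =
        soloAction S Y ⟨s, s.2.trans t.2⟩ := fun s =>
      ih ⟨s, s.2.trans t.2⟩ s.2 fun i a r hr => h i a r (hr.trans s.2)
    rw [soloAction, soloAction]
    simp only [hact]
    congr 1
    funext s
    exact h _ _ _ s.2

theorem condTableExp_soloReward (p θ : ℝ) (S : SoloStrategy T) :
    condTableExp p θ (fun X : RewardTable Unit T => ∑ t, bitValue (X () (soloAction S X t) t)) =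
      ∑ t, condTableExp p θ (fun X => successProb p θ (soloAction S X t)) := by
  rw [condTableExp_sum]
  exact Finset.sum_congr rfl fun t _ =>
    condTableExp_bitValue_choice p θ (fun X => soloAction S X t) () t fun X a =>
      soloAction_congr S t fun _ _ _ hs => flipBit_of_ne_round X () a hs.ne _ _

open Classical in
/-- The indicator of the event that a single player explores. -/
def soloExplores (S : SoloStrategy T) (X : RewardTable Unit T) : ℝ :=
  if ∃ t : Fin (T + 1), soloAction S X t = .right then 1 else 0

theorem soloExploreProb_eq (μ : Measure ℝ) (σ : SoloMixed T) :
    soloExploreProb p μ σ = ∑ S, σ.1 S * tableExp p μ (soloExplores S) := rfl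

variable {μ : Measure ℝ} [IsProbabilityMeasure μ]

/-- Without exploration the expected reward is `p` per round. -/
theorem tableExp_soloReward_le (hμ : μ (Set.Icc (0 : ℝ) 1) = 1) (hp : p ∈ Set.Icc (0 : ℝ) 1)
    (S : SoloStrategy T) :
    tableExp p μ (fun X : RewardTable Unit T => ∑ t, bitValue (X () (soloAction S X t) t)) ≤
      (T + 1) * p + (T + 1) * tableExp p μ (soloExplores S) := by
  have hle : ∀ᵐ θ ∂μ, condTableExp p θ
      (fun X : RewardTable Unit T => ∑ t, bitValue (X () (soloAction S X t) t)) ≤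
      (T + 1) * p + (T + 1) * condTableExp p θ (soloExplores S) := by
    filter_upwards [ae_mem_Icc hμ] with θ hθ
    -- A right pull is worth `θ ≤ 1 ≤ p + 1`, and it occurs only if the indicator is one.
    have hround : ∀ t, condTableExp p θ (fun X => successProb p θ (soloAction S X t)) ≤
        p + condTableExp p θ (soloExplores S) := by
      intro t
      have hadd := condTableExp_add p θ (fun _ : RewardTable Unit T => p) (soloExplores S)
      rw [condTableExp_const] at hadd
      rw [← hadd]
      refine condTableExp_mono hp hθ fun X => ?_
      have h0 : 0 ≤ soloExplores S X := by
        unfold soloExplores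
        split_ifs <;> norm_num
      cases h : soloAction S X t
      · simpa [successProb] using h0
      · have h1 : soloExplores S X = 1 := if_pos ⟨t, h⟩
        simp only [successProb, h1]
        linarith [hθ.2, hp.1]
    rw [condTableExp_soloReward]
    calc _ ≤ ∑ _t : Fin (T + 1), (p + condTableExp p θ (soloExplores S)) :=
          Finset.sum_le_sum fun t _ => hround t
      _ = _ := by simp
  have hint := integrable_condTableExp (p := p) hμ (soloExplores S)
  refine (integral_mono_ae (integrable_condTableExp hμ _)
    ((integrable_const _).add (hint.const_mul _)) hle).trans_eq ?_
  simp only [Pi.add_apply]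
  rw [integral_add (integrable_const _) (hint.const_mul _), tableExp_eq,
    integral_const_mul ((T : ℝ) + 1) fun θ => condTableExp p θ (soloExplores S)]
  simp

/-- The strategy that pulls the right arm in the first `N` rounds and keeps pulling it if and
only if all these pulls are successful. -/
def trialStrategy (N : ℕ) : SoloStrategy T := fun t _ r =>
  if t.val < N ∨ ∀ s : Fin t, s.val < N → r s = true then .right else .left

theorem soloAction_trialStrategy_of_lt {N : ℕ} (X : RewardTable Unit T) {t : Fin (T + 1)}
    (h : t.val < N) : soloAction (trialStrategy N) X t = .right := by
  rw [soloAction]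
  exact if_pos (.inl h)

/-- The product of bits is the indicator of a perfect trial; the observed rewards are right bits
because the first `N` pulls are all right. -/
theorem successProb_soloAction_trialStrategy {N : ℕ} (hN : N ≤ T + 1) (θ : ℝ)
    (X : RewardTable Unit T) {t : Fin (T + 1)} (h : N ≤ t.val) :
    successProb p θ (soloAction (trialStrategy N) X t) =
      p + (θ - p) * ∏ s : Fin N, bitValue (X () .right ⟨s, s.2.trans_le hN⟩) := by
  rw [soloAction]
  by_cases hall : ∀ s : Fin N, X () .right ⟨s, s.2.trans_le hN⟩ = true
  · have h1 : ∏ s : Fin N, bitValue (X () .right ⟨s, s.2.trans_le hN⟩) = 1 :=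
      Finset.prod_eq_one fun s _ => by simp [hall s, bitValue]
    rw [h1, trialStrategy, if_pos]
    · simp [successProb]
    · refine .inr fun s hs => ?_
      rw [soloAction_trialStrategy_of_lt X (by exact hs)]
      exact hall ⟨s, hs⟩
  · push Not at hall
    obtain ⟨s, hs⟩ := hall
    have h1 : ∏ s : Fin N, bitValue (X () .right ⟨s, s.2.trans_le hN⟩) = 0 :=
      Finset.prod_eq_zero (Finset.mem_univ s) (by simp [hs, bitValue])
    rw [h1, trialStrategy, if_neg]
    · simp [successProb]
    · rintro (hlt | hr)
      · omega
      · have := hr ⟨s, s.2.trans_le h⟩ s.2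
        rw [soloAction_trialStrategy_of_lt X (by exact s.2)] at this
        exact hs this

/-- The excess over `(T + 1) * p` separates into a trial term independent of `T` and a term whose
integral against `μ` grows linearly in `T` when `∫ θ ^ N * (θ - p)` is positive. -/
theorem condTableExp_trialStrategy {N : ℕ} (hN : N ≤ T + 1) (p θ : ℝ) :
    condTableExp p θ (fun X : RewardTable Unit T =>
      ∑ t, bitValue (X () (soloAction (trialStrategy N) X t) t)) =
      (T + 1) * p + N * (θ - p) + (T + 1 - N) * (θ ^ N * (θ - p)) := by
  have hround : ∀ t : Fin (T + 1),
      condTableExp p θ (fun X => successProb p θ (soloAction (trialStrategy N) X t)) =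
        if t.val < N then θ else p + (θ - p) * θ ^ N := by
    intro t
    split_ifs with h
    · simp only [soloAction_trialStrategy_of_lt _ h]
      exact condTableExp_const p θ θ
    · simp only [successProb_soloAction_trialStrategy hN θ _ (not_lt.1 h)]
      rw [condTableExp_add p θ (fun _ => p), condTableExp_const, condTableExp_const_mul,
        condTableExp_prod_bitValue p θ () hN]
  rw [condTableExp_soloReward]
  simp only [hround]
  rw [Fin.sum_univ_eq_sum_range (fun t => if t < N then θ else p + (θ - p) * θ ^ N) (T + 1),
    ← Finset.sum_range_add_sum_Ico _ hN,
    Finset.sum_congr rfl fun t ht => if_pos (Finset.mem_range.1 ht),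
    Finset.sum_congr rfl fun t ht => if_neg (not_lt.2 (Finset.mem_Ico.1 ht).1)]
  simp only [Finset.sum_const, Finset.card_range, Nat.card_Ico, nsmul_eq_mul, Nat.cast_sub hN]
  push_cast
  ring

/-- If `p` is below the maximum of the support, then optimal play over a long horizon explores
with positive probability. -/
theorem exists_soloExploreProb_pos (hμ : μ (Set.Icc (0 : ℝ) 1) = 1) (hp : p ∈ Set.Icc (0 : ℝ) 1)
    (h : p < priorMax μ) : ∃ T₀ : ℕ, ∀ T : ℕ, T₀ ≤ T →
      ∀ σ : SoloMixed T, IsSoloOptimal p μ σ → 0 < soloExploreProb p μ σ := by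
  obtain ⟨N, hN⟩ := exists_pow_integral_pos hμ hp.1 hp.2 h
  set g := ∫ θ, θ ^ N * (θ - p) ∂μ with hg
  -- `K` rounds after the trial, each gaining `g`, outweigh the trial cost `N * (p - m)`.
  obtain ⟨K, hK⟩ := exists_nat_gt (N * (p - priorMean μ) / g)
  rw [div_lt_iff₀ hN] at hK
  refine ⟨N + K, fun T hT σ hσ => ?_⟩
  have hNT : N ≤ T + 1 := by omega
  have hup : soloExpReward p μ σ ≤ (T + 1) * p + (T + 1) * soloExploreProb p μ σ := by
    calc soloExpReward p μ σ
        ≤ ∑ S, σ.1 S * ((T + 1) * p + (T + 1) * tableExp p μ (soloExplores S)) :=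
          Finset.sum_le_sum fun S _ =>
            mul_le_mul_of_nonneg_left (tableExp_soloReward_le hμ hp S) (σ.2.1 S)
      _ = _ := by
          have h1 : ∑ S, σ.1 S * ((T + 1) * p) = (T + 1) * p := by
            rw [← Finset.sum_mul, σ.2.2, one_mul]
          simp only [mul_add (σ.1 _), Finset.sum_add_distrib, h1, soloExploreProb_eq,
            Finset.mul_sum, mul_left_comm (σ.1 _) ((T : ℝ) + 1) (tableExp _ _ _)]
  have hlow : soloExpReward p μ (pureMixed (trialStrategy N : SoloStrategy T)) =
      (T + 1) * p + N * (priorMean μ - p) + (T + 1 - N) * g := by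
    rw [soloExpReward, sum_pureMixed_mul (trialStrategy N : SoloStrategy T), tableExp_eq]
    simp only [condTableExp_trialStrategy hNT]
    have hid : Integrable (fun θ : ℝ => θ) μ := integrable_of_continuous hμ continuous_id
    rw [integral_add, integral_add, integral_const_mul, integral_const_mul,
      integral_sub hid (integrable_const _)]
    · rw [integral_const_mul, ← hg]
      simp [priorMean]
    all_goals exact integrable_of_continuous hμ (by fun_prop)
  have hopt := hσ (pureMixed (trialStrategy N))
  have hKT : (K : ℝ) ≤ T + 1 - N := by
    have : ((N + K : ℕ) : ℝ) ≤ T := by exact_mod_cast hT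
    push_cast at this
    linarith
  have hKg : (K : ℝ) * g ≤ (T + 1 - N) * g := mul_le_mul_of_nonneg_right hKT hN.le
  -- By optimality this product is at least `N * (m - p) + (T + 1 - N) * g`, which is at least `K *
  -- g - N * (p - m) > 0`.
  have hpos : 0 < ((T : ℝ) + 1) * soloExploreProb p μ σ := by linarith
  exact pos_of_mul_pos_right hpos (by positivity)

end Solo

end

theorem theorem6 (μ : MeasureTheory.Measure ℝ) [MeasureTheory.IsProbabilityMeasure μ]
    (hμ : μ (Set.Icc (0 : ℝ) 1) = 1) :
    (∀ (T : ℕ) (d : DrawRule) (p : ℝ), p ∈ Set.Icc (0 : ℝ) 1 →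
      (priorMean μ + priorMax μ) / 2 < p →
      ∀ σA σB : MixedStrategy T, IsNash (-1) d p μ σA σB →
        exploreProb d p μ σA σB = 0) ∧
    (∀ p : ℝ, p ∈ Set.Icc (0 : ℝ) 1 → p < priorMax μ →
      ∃ T₀ : ℕ, ∀ T : ℕ, T₀ ≤ T →
        ∀ σ : SoloMixed T, IsSoloOptimal p μ σ → 0 < soloExploreProb p μ σ) :=
  ⟨fun _ d _ hp hlt _ _ h => exploreProb_eq_zero_of_isNash d hμ hp hlt h,
    fun _ hp h => exists_soloExploreProb_pos hμ hp h⟩
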